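/- **Policy improvement with partial policy learning.** Let $(S,A,P,r,\gamma)$ be a discounted Markov decision process with measurable state space $S$ and action space $A$, transition kernel $P(\cdot\mid s,a)$, bounded measurable reward $r:S\times A\to\mathbb R$, discount factor $\gamma\in[0,1)$ and initial state distribution $\mu_0$. A policy is a Markov kernel $\pi(\cdot\mid s)$ from $S$ to $A$. For a policy $\pi$ let $$J(\pi)=\mathbb E_\pi\Big[\sum_{t=0}^\infty\gamma^t r(s_t,a_t)\Big],\qquad s_0\sim\mu_0,\ a_t\sim\pi(\cdot\mid s_t),\ s_{t+1}\sim P(\cdot\mid s_t,a_t),$$ let $Q^\pi(s,a)$ be the expected value of $\sum_{t\ge0}\gamma^t r(s_t,a_t)$ when $s_0=s$, $a_0=a$ and $\pi$ is followed from time $1$ on, and let $d^\pi=(1-\gamma)\sum_{t\ge0}\gamma^t\,\mathrm{Law}_\pi(s_t)$ be the normalised discounted state distribution of $\pi$. Let $\beta$ be a policy (the behaviour, or expert, policy) and let $w\in[1,\infty]$. Suppose that the policy $\pi$ is a solution of the partial (extremal) optimal transport problem $$\min_{\pi'}\ \mathbb E_{s\sim d^\beta,\ a\sim\pi'(\cdot\mid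 s)}\big[-Q^\beta(s,a)\big]\quad\text{over policies }\pi'\text{ with}\quad \pi'(\cdot\mid s)\le w\,\beta(\cdot\mid s)\ \text{ for } d^\beta\text{-almost every } s,$$ where the inequality is between measures on $A$, and for $w=\infty$ it means that $\pi'(\cdot\mid s)$ is absolutely continuous with respect to $\beta(\cdot\mid s)$. Then $$J(\pi)\ge J(\beta).$$ -/

import Mathlib

open MeasureTheory ProbabilityTheory
open scoped ENNReal

noncomputable section

namespace OfflineRL

/-- A discounted Markov decision process with (measurable) state space `S`, action space `A`,
transition probability `P`, bounded measurable reward `r`, discount factor `γ ∈ [0, 1)` and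
distribution `μ₀` of the initial state. -/
structure MDP (S A : Type*) [MeasurableSpace S] [MeasurableSpace A] where
  P : Kernel (S × A) S
  markov_P : IsMarkovKernel P
  r : S × A → ℝ
  measurable_r : Measurable r
  bounded_r : ∃ R : ℝ, ∀ p, |r p| ≤ R
  γ : ℝ
  γ_nonneg : 0 ≤ γ
  γ_lt_one : γ < 1
  μ₀ : Measure S
  prob_μ₀ : IsProbabilityMeasure μ₀

attribute [instance] MDP.markov_P MDP.prob_μ₀

namespace MDP

variable {S A : Type*} [MeasurableSpace S] [MeasurableSpace A]

/-- One step of the state-action chain under the policy `π`: from `(s, a)`, draw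
`s' ∼ P(· | s, a)` and then `a' ∼ π(· | s')`. -/
def step (M : MDP S A) (π : Kernel S A) : Kernel (S × A) (S × A) :=
  M.P.compProd (Kernel.prodMkLeft (S × A) π)

instance (M : MDP S A) (π : Kernel S A) [IsMarkovKernel π] : IsMarkovKernel (M.step π) := by
  unfold step; infer_instance

/-- The law of the trajectory `(s₀, a₀), (s₁, a₁), …` when `(s₀, a₀) ∼ ν` and all later actions are
drawn from `π`. -/
def pathMeasure (M : MDP S A) (π : Kernel S A) [IsMarkovKernel π] (ν : Measure (S × A)) :
    Measure (ℕ → S × A) :=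
  Kernel.trajMeasure (X := fun _ => S × A) ν
    (fun n => (M.step π).comap (fun h => h ⟨n, Finset.mem_Iic.2 le_rfl⟩)
      (measurable_pi_apply _))

/-- The law of the trajectory obtained by following `π` from `s₀ ∼ μ₀`. -/
def policyMeasure (M : MDP S A) (π : Kernel S A) [IsMarkovKernel π] : Measure (ℕ → S × A) :=
  M.pathMeasure π (M.μ₀.compProd π)

/-- The discounted return `∑ₜ γᵗ r(sₜ, aₜ)` of a trajectory. -/
def discountedReturn (M : MDP S A) (ω : ℕ → S × A) : ℝ :=
  ∑' t, M.γ ^ t * M.r (ω t)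

/-- The performance `J(π) = E_π[∑ₜ γᵗ r(sₜ, aₜ)]`. -/
def J (M : MDP S A) (π : Kernel S A) [IsMarkovKernel π] : ℝ :=
  ∫ ω, M.discountedReturn ω ∂(M.policyMeasure π)

/-- The critic `Q^π(s, a)`: the expected discounted return of the trajectory that starts in `s`
with action `a` and follows `π` afterwards. -/
def Q (M : MDP S A) (π : Kernel S A) [IsMarkovKernel π] (s : S) (a : A) : ℝ :=
  ∫ ω, M.discountedReturn ω ∂(M.pathMeasure π (Measure.dirac (s, a)))

/-- The (normalised, discounted) state distribution of `π`,
`d^π = (1 - γ) ∑ₜ γᵗ · Law_π(sₜ)`. -/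
def stateDist (M : MDP S A) (π : Kernel S A) [IsMarkovKernel π] : Measure S :=
  Measure.sum fun t : ℕ =>
    ENNReal.ofReal ((1 - M.γ) * M.γ ^ t) • (M.policyMeasure π).map (fun ω => (ω t).1)

/-- The constraint `π♯d(s) ≤ w β(·|s)` of the state-conditional partial transport problem: the
action distribution into which `π` transports the mass at `s` is dominated, as a measure, by
`w β(·|s)`, for `d^β`-almost every `s`. For `w = ∞` it says that `π(·|s)` is absolutely continuous
with respect to `β(·|s)`. -/
def IsFeasible (M : MDP S A) (β : Kernel S A) [IsMarkovKernel β] (w : ℝ≥0∞) (π : Kernel S A) :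
    Prop :=
  ∀ᵐ s ∂(M.stateDist β), π s ≤ w • β s

/-- The partial transport cost `E_{s ∼ d^β, a ∼ π(s)}[-Q^β(s, a)]`. -/
def cost (M : MDP S A) (β : Kernel S A) [IsMarkovKernel β] (π : Kernel S A) : ℝ :=
  ∫ s, ∫ a, -M.Q β s a ∂(π s) ∂(M.stateDist β)

/-- `π` solves the partial optimal transport problem with cost `-Q^β`, behaviour policy `β` and
unbalance coefficient `w`. -/
def IsPartialOTSolution (M : MDP S A) (β : Kernel S A) [IsMarkovKernel β] (w : ℝ≥0∞)
    (π : Kernel S A) : Prop :=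
  M.IsFeasible β w π ∧
    ∀ (π' : Kernel S A) [IsMarkovKernel π'], M.IsFeasible β w π' → M.cost β π ≤ M.cost β π'

end MDP

end OfflineRL

end

noncomputable section

namespace OfflineRL

namespace MDP

variable {S A : Type*} [MeasurableSpace S] [MeasurableSpace A]

section Integral

variable {α δ : Type*} [MeasurableSpace α] [MeasurableSpace δ]

/-! The transport constraint acts state by state, and `β` meets it because `1 ≤ w`. Replacing `π` by
`β` wherever `β` has the larger mean of `Q^β` therefore stays feasible, so by optimality those
states are `d^β`-null (`IsPartialOTSolution.ae_integral_Q_le`).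

Then compare the policies that follow `π` for `n` steps and `β` afterwards: the return does not
decrease with `n` (`IsPartialOTSolution.expReturn_le`) and tends to `J(π)`. The a.e. inequality
applies along the chain of `π` because feasibility forces `π(s) ≪ β(s)`, which keeps its state laws
absolutely continuous with respect to `d^β` (`IsFeasible.fst_law_absolutelyContinuous`). -/

lemma integrable_of_measurable_of_abs_le {μ : Measure α} [IsFiniteMeasure μ] {f : α → ℝ} {C : ℝ}
    (hf : Measurable f) (hC : ∀ x, |f x| ≤ C) : Integrable f μ :=
  Integrable.of_bound hf.aestronglyMeasurable C
    (ae_of_all _ fun x => (Real.norm_eq_abs _).trans_le (hC x))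

lemma abs_integral_le_of_abs_le {μ : Measure α} [IsProbabilityMeasure μ] {f : α → ℝ} {C : ℝ}
    (hC : ∀ x, |f x| ≤ C) : |∫ x, f x ∂μ| ≤ C := by
  simpa using norm_integral_le_of_norm_le_const (μ := μ) (f := f) (C := C)
    (ae_of_all _ fun x => (Real.norm_eq_abs _).trans_le (hC x))

lemma comap_comp_eq_comp_map {ε : Type*} [MeasurableSpace ε] (κ : Kernel δ ε) {g : α → δ}
    (hg : Measurable g) (μ : Measure α) : κ.comap g hg ∘ₘ μ = κ ∘ₘ μ.map g := by
  ext s hs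
  rw [Measure.bind_apply hs (Kernel.aemeasurable _), Measure.bind_apply hs (Kernel.aemeasurable _),
    lintegral_map (κ.measurable_coe hs) hg]
  rfl

end Integral

/-- The law of `(sₙ, aₙ)` along the trajectory of `π` started from `ν`. -/
def law (M : MDP S A) (π : Kernel S A) [IsMarkovKernel π] (ν : Measure (S × A)) (n : ℕ) :
    Measure (S × A) :=
  (M.pathMeasure π ν).map (fun ω => ω n)

/-- The expected discounted return of the trajectory of `π` started from `ν`. -/
def expReturn (M : MDP S A) (π : Kernel S A) [IsMarkovKernel π] (ν : Measure (S × A)) : ℝ :=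
  ∫ ω, M.discountedReturn ω ∂(M.pathMeasure π ν)

/-! ### Trajectory laws and their one-step recursion -/

section Path

variable (M : MDP S A) (π : Kernel S A) [IsMarkovKernel π]

/-- The kernel sending `(s, a)` to the law of the trajectory started from it. -/
def pathKernel : Kernel (S × A) (ℕ → S × A) :=
  (Kernel.traj (X := fun _ => S × A)
    (fun n => (M.step π).comap (fun h => h ⟨n, Finset.mem_Iic.2 le_rfl⟩)
      (measurable_pi_apply _)) 0).comap
    (MeasurableEquiv.piUnique (fun _ : Finset.Iic 0 => S × A)).symm (MeasurableEquiv.measurable _)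

instance : IsMarkovKernel (M.pathKernel π) := by
  unfold pathKernel; infer_instance

/-- Disintegration over the starting pair; it turns `Q` into a kernel integral, hence measurable. -/
lemma pathMeasure_eq_comp (ν : Measure (S × A)) : M.pathMeasure π ν = M.pathKernel π ∘ₘ ν := by
  rw [pathKernel, comap_comp_eq_comp_map]
  rfl

lemma pathMeasure_dirac (p : S × A) :
    M.pathMeasure π (Measure.dirac p) = M.pathKernel π p := by
  rw [pathMeasure_eq_comp]
  exact Measure.dirac_bind (Kernel.measurable _) p

instance (ν : Measure (S × A)) [IsProbabilityMeasure ν] :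
    IsProbabilityMeasure (M.pathMeasure π ν) := by
  rw [pathMeasure_eq_comp]; infer_instance

instance (ν : Measure (S × A)) [IsProbabilityMeasure ν] (n : ℕ) :
    IsProbabilityMeasure (M.law π ν n) :=
  Measure.isProbabilityMeasure_map (measurable_pi_apply n).aemeasurable

lemma law_zero (ν : Measure (S × A)) : M.law π ν 0 = ν := by
  have h : (fun ω : ℕ → S × A => ω 0) =
      (fun h : Finset.Iic 0 → S × A => h ⟨0, Finset.mem_Iic.2 le_rfl⟩) ∘
        Preorder.frestrictLe (π := fun _ : ℕ => S × A) 0 := rfl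
  rw [law, h, ← Measure.map_map (by fun_prop) (by fun_prop), pathMeasure, Kernel.trajMeasure,
    Measure.map_comp _ _ (by fun_prop), Kernel.traj_map_frestrictLe, Kernel.partialTraj_self,
    Measure.id_comp, Measure.map_map (by fun_prop) (by fun_prop)]
  exact Measure.map_id

variable (ν : Measure (S × A)) [IsProbabilityMeasure ν]

lemma law_succ (n : ℕ) : M.law π ν (n + 1) = M.step π ∘ₘ M.law π ν n := by
  have h := congrArg Measure.snd (Kernel.map_frestrictLe_trajMeasure_compProd_eq_map_trajMeasure
    (X := fun _ => S × A) (μ₀ := ν)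
    (κ := fun n => (M.step π).comap (fun h => h ⟨n, Finset.mem_Iic.2 le_rfl⟩)
      (measurable_pi_apply _)) (a := n))
  rw [Measure.snd_compProd, comap_comp_eq_comp_map, Measure.map_map (by fun_prop) (by fun_prop),
    Measure.snd, Measure.map_map (by fun_prop) (by fun_prop)] at h
  exact h.symm

lemma law_step_comp (n : ℕ) : M.law π (M.step π ∘ₘ ν) n = M.law π ν (n + 1) := by
  induction n with
  | zero => rw [law_zero, law_succ, law_zero]
  | succ n ih => rw [law_succ, ih, ← law_succ]

lemma step_comp : M.step π ∘ₘ ν = (M.P ∘ₘ ν) ⊗ₘ π := by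
  ext s hs
  rw [Measure.bind_apply hs (Kernel.aemeasurable _), Measure.compProd_apply hs,
    Measure.lintegral_bind (Kernel.aemeasurable _)
      (Kernel.measurable_kernel_prodMk_left hs).aemeasurable]
  refine lintegral_congr fun p => ?_
  rw [step, Kernel.compProd_apply hs]
  rfl

end Path

/-! ### Expected returns and the Bellman equation -/

section Return

variable (M : MDP S A)

lemma summable_pow_mul_const (R : ℝ) : Summable fun t : ℕ => M.γ ^ t * R :=
  (summable_geometric_of_lt_one M.γ_nonneg M.γ_lt_one).mul_right R

lemma abs_pow_mul_le {R x : ℝ} (h : |x| ≤ R) (t : ℕ) : |M.γ ^ t * x| ≤ M.γ ^ t * R := by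
  rw [abs_mul, abs_of_nonneg (pow_nonneg M.γ_nonneg t)]
  exact mul_le_mul_of_nonneg_left h (pow_nonneg M.γ_nonneg t)

lemma hasSum_discountedReturn (ω : ℕ → S × A) :
    HasSum (fun t => M.γ ^ t * M.r (ω t)) (M.discountedReturn ω) := by
  obtain ⟨R, hR⟩ := M.bounded_r
  exact ((M.summable_pow_mul_const R).of_norm_bounded
    fun t => M.abs_pow_mul_le (hR _) t).hasSum

lemma measurable_discountedReturn : Measurable M.discountedReturn := by
  refine measurable_of_tendsto_metrizable
    (f := fun n ω => ∑ t ∈ Finset.range n, M.γ ^ t * M.r (ω t)) (fun n => ?_)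
    (tendsto_pi_nhds.2 fun ω => (M.hasSum_discountedReturn ω).tendsto_sum_nat)
  have := M.measurable_r
  fun_prop

lemma exists_abs_discountedReturn_le : ∃ C, ∀ ω, |M.discountedReturn ω| ≤ C := by
  obtain ⟨R, hR⟩ := M.bounded_r
  refine ⟨∑' t, M.γ ^ t * R, fun ω => ?_⟩
  rw [← Real.norm_eq_abs]
  exact tsum_of_norm_bounded (M.summable_pow_mul_const R).hasSum
    fun t => M.abs_pow_mul_le (hR (ω t)) t

variable (π : Kernel S A) [IsMarkovKernel π]

lemma measurable_Q : Measurable fun p : S × A => M.Q π p.1 p.2 := by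
  simp only [Q, pathMeasure_dirac]
  exact (M.measurable_discountedReturn.stronglyMeasurable.integral_kernel
    (κ := M.pathKernel π)).measurable

lemma exists_abs_Q_le : ∃ C, ∀ s a, |M.Q π s a| ≤ C := by
  obtain ⟨C, hC⟩ := M.exists_abs_discountedReturn_le
  exact ⟨C, fun s a => abs_integral_le_of_abs_le hC⟩

lemma exists_abs_expReturn_le :
    ∃ C, ∀ (ν : Measure (S × A)) [IsProbabilityMeasure ν], |M.expReturn π ν| ≤ C := by
  obtain ⟨C, hC⟩ := M.exists_abs_discountedReturn_le
  exact ⟨C, fun ν _ => abs_integral_le_of_abs_le hC⟩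

variable (ν : Measure (S × A)) [IsProbabilityMeasure ν]

lemma expReturn_eq_integral_Q : M.expReturn π ν = ∫ p, M.Q π p.1 p.2 ∂ν := by
  obtain ⟨C, hC⟩ := M.exists_abs_discountedReturn_le
  simp only [expReturn, Q, pathMeasure_dirac]
  rw [pathMeasure_eq_comp, Measure.comp_eq_comp_const_apply, Kernel.integral_comp
    (integrable_of_measurable_of_abs_le M.measurable_discountedReturn hC), Kernel.const_apply]

lemma hasSum_expReturn :
    HasSum (fun t => M.γ ^ t * ∫ p, M.r p ∂(M.law π ν t)) (M.expReturn π ν) := by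
  obtain ⟨R, hR⟩ := M.bounded_r
  have hr := M.measurable_r
  have h := hasSum_integral_of_dominated_convergence (μ := M.pathMeasure π ν)
    (F := fun t ω => M.γ ^ t * M.r (ω t)) (f := M.discountedReturn) (fun t _ => M.γ ^ t * R)
    (fun t => Measurable.aestronglyMeasurable (by fun_prop)) (fun t => ae_of_all _ fun ω => M.abs_pow_mul_le (hR _) t)
    (ae_of_all _ fun _ => M.summable_pow_mul_const R) (integrable_const _)
    (ae_of_all _ M.hasSum_discountedReturn)
  refine (congrArg (HasSum · _) (funext fun t => ?_)).mpr h
  rw [integral_const_mul, law, integral_map (measurable_pi_apply t).aemeasurable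
    hr.aestronglyMeasurable]

/-- Bellman equation: split off the term `t = 0` and restart the chain one step later. -/
lemma expReturn_eq_add :
    M.expReturn π ν = ∫ p, M.r p ∂ν + M.γ * M.expReturn π (M.step π ∘ₘ ν) := by
  rw [← (M.hasSum_expReturn π ν).tsum_eq, (M.hasSum_expReturn π ν).summable.tsum_eq_zero_add,
    ← (M.hasSum_expReturn π (M.step π ∘ₘ ν)).tsum_eq, ← tsum_mul_left, law_zero]
  simp only [law_step_comp, pow_zero, one_mul, pow_succ']
  simp only [mul_assoc]

lemma expReturn_compProd (m : Measure S) [IsProbabilityMeasure m] (η : Kernel S A)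
    [IsMarkovKernel η] :
    M.expReturn π (m ⊗ₘ η) = ∫ s, ∫ a, M.Q π s a ∂(η s) ∂m := by
  obtain ⟨C, hC⟩ := M.exists_abs_Q_le π
  rw [expReturn_eq_integral_Q, Measure.integral_compProd
    (integrable_of_measurable_of_abs_le (M.measurable_Q π) fun p => hC p.1 p.2)]

end Return

/-! ### Statewise improvement and performance comparison -/

section Optimality

variable (M : MDP S A) (β : Kernel S A) [IsMarkovKernel β]

instance : IsFiniteMeasure (M.stateDist β) := by
  refine ⟨?_⟩
  have h (t : ℕ) : (M.policyMeasure β).map (fun ω => (ω t).1) Set.univ = 1 := by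
    have : IsProbabilityMeasure (M.policyMeasure β) := by unfold policyMeasure; infer_instance
    rw [Measure.map_apply (by fun_prop) .univ, Set.preimage_univ, measure_univ]
  rw [stateDist, Measure.sum_apply _ .univ]
  simp only [Measure.smul_apply, h, smul_eq_mul, mul_one]
  exact ((summable_geometric_of_lt_one M.γ_nonneg M.γ_lt_one).mul_left (1 - M.γ)).tsum_ofReal_lt_top

/-- The guard `M.γ ^ t ≠ 0` matters when `γ = 0`: then `d^β` sees only time `0`. -/
lemma ae_stateDist_iff {p : S → Prop} :
    (∀ᵐ s ∂(M.stateDist β), p s) ↔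
      ∀ t, M.γ ^ t ≠ 0 → ∀ᵐ s ∂(M.law β (M.μ₀ ⊗ₘ β) t).fst, p s := by
  rw [stateDist, Measure.ae_sum_iff]
  refine forall_congr' fun t => ?_
  have hlaw : (M.policyMeasure β).map (fun ω => (ω t).1) = (M.law β (M.μ₀ ⊗ₘ β) t).fst := by
    rw [Measure.fst, law, Measure.map_map (by fun_prop) (by fun_prop)]
    rfl
  rw [hlaw]
  by_cases h : M.γ ^ t = 0
  · simp [h]
  · have : ENNReal.ofReal ((1 - M.γ) * M.γ ^ t) ≠ 0 := by
      rw [Ne, ENNReal.ofReal_eq_zero, not_le]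
      exact mul_pos (sub_pos.2 M.γ_lt_one) ((pow_nonneg M.γ_nonneg t).lt_of_ne' h)
    rw [Measure.ae_ennreal_smul_measure_iff this]
    simp [h]

lemma law_eq_compProd (π : Kernel S A) [IsMarkovKernel π] (n : ℕ) :
    M.law π (M.μ₀ ⊗ₘ π) n = (M.law π (M.μ₀ ⊗ₘ π) n).fst ⊗ₘ π := by
  cases n with
  | zero => rw [law_zero, Measure.fst_compProd]
  | succ n => rw [law_succ, step_comp, Measure.fst_compProd]

lemma fst_law_succ (π : Kernel S A) [IsMarkovKernel π] (ν : Measure (S × A))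
    [IsProbabilityMeasure ν] (n : ℕ) :
    (M.law π ν (n + 1)).fst = M.P ∘ₘ M.law π ν n := by
  rw [law_succ, step_comp, Measure.fst_compProd]

/-- The transitions of the behaviour policy do not leave the null sets of `d^β`. -/
lemma comp_compProd_stateDist_absolutelyContinuous (hγ : M.γ ≠ 0) :
    M.P ∘ₘ (M.stateDist β ⊗ₘ β) ≪ M.stateDist β := by
  refine Measure.AbsolutelyContinuous.mk fun N hN h0 => ?_
  have hmeas := M.P.measurable_coe hN
  rw [measure_eq_zero_iff_ae_notMem] at h0
  rw [Measure.bind_apply hN (Kernel.aemeasurable _), lintegral_eq_zero_iff hmeas]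
  refine (Measure.ae_compProd_iff (hmeas (measurableSet_singleton 0))).2
    ((M.ae_stateDist_iff β).2 fun t _ => ?_)
  -- A transition from time `t` lands at time `t + 1`, whose weight is positive since `γ ≠ 0`.
  have h1 := (M.ae_stateDist_iff β).1 h0 (t + 1) (pow_ne_zero _ hγ)
  rw [← measure_eq_zero_iff_ae_notMem, fst_law_succ, Measure.bind_apply hN (Kernel.aemeasurable _),
    lintegral_eq_zero_iff hmeas, law_eq_compProd] at h1
  exact Measure.ae_ae_of_ae_compProd h1

variable {M β} {w : ℝ≥0∞} {π : Kernel S A} [IsMarkovKernel π]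

lemma IsFeasible.fst_law_absolutelyContinuous (h : M.IsFeasible β w π) {n : ℕ}
    (hn : M.γ ^ n ≠ 0) :
    (M.law π (M.μ₀ ⊗ₘ π) n).fst ≪ M.stateDist β := by
  induction n with
  | zero =>
    rw [law_zero, Measure.fst_compProd]
    refine Measure.AbsolutelyContinuous.mk fun N _ h0 => ?_
    rw [measure_eq_zero_iff_ae_notMem] at h0 ⊢
    simpa [law_zero] using (M.ae_stateDist_iff β).1 h0 0
  | succ n ih =>
    have hγ : M.γ ≠ 0 := fun h0 => hn (by simp [h0])
    have ih := ih (pow_ne_zero _ hγ)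
    rw [fst_law_succ, law_eq_compProd]
    -- Compare with one step of `β` from `d^β`, which stays absolutely continuous with respect to
    -- `d^β`.
    refine Measure.AbsolutelyContinuous.trans (Measure.AbsolutelyContinuous.comp_right ?_ M.P)
      (M.comp_compProd_stateDist_absolutelyContinuous β hγ)
    refine Measure.AbsolutelyContinuous.compProd ih (ih.ae_le (h.mono fun s hs => ?_))
    exact (Measure.absolutelyContinuous_of_le hs).trans Measure.smul_absolutelyContinuous

/-- A solution of the partial transport problem improves on `β` at `d^β`-almost every state. -/
lemma IsPartialOTSolution.ae_integral_Q_le (h : M.IsPartialOTSolution β w π) (hw : 1 ≤ w) :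
    ∀ᵐ s ∂(M.stateDist β), ∫ a, M.Q β s a ∂(β s) ≤ ∫ a, M.Q β s a ∂(π s) := by
  classical
  obtain ⟨C, hC⟩ := M.exists_abs_Q_le β
  have hm (η : Kernel S A) [IsMarkovKernel η] : Measurable fun s => ∫ a, M.Q β s a ∂(η s) :=
    (M.measurable_Q β).stronglyMeasurable.integral_kernel_prod_right'.measurable
  have hi (η : Kernel S A) [IsMarkovKernel η] :
      Integrable (fun s => ∫ a, M.Q β s a ∂(η s)) (M.stateDist β) :=
    integrable_of_measurable_of_abs_le (hm η) fun s => abs_integral_le_of_abs_le (hC s)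
  have hB : MeasurableSet {s | ∫ a, M.Q β s a ∂(π s) < ∫ a, M.Q β s a ∂(β s)} :=
    measurableSet_lt (hm π) (hm β)
  -- The competitor plays `β` exactly where `π` is strictly worse.
  let π' := Kernel.piecewise hB β π
  have hle (s : S) : ∫ a, M.Q β s a ∂(π s) ≤ ∫ a, M.Q β s a ∂(π' s) := by
    simp only [π', Kernel.piecewise_apply]
    split_ifs with hs
    · exact (Set.mem_ofPred.1 hs).le
    · exact le_rfl
  have hfeas : M.IsFeasible β w π' := by
    filter_upwards [h.1] with s hs
    simp only [π', Kernel.piecewise_apply]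
    split_ifs
    · exact Measure.le_intro fun t _ _ => le_mul_of_one_le_left zero_le hw
    · exact hs
  have hcost := h.2 π' hfeas
  simp only [cost, integral_neg, neg_le_neg_iff] at hcost
  -- Ordered integrands with equal integrals agree a.e., so the bad set is null.
  have hae := (integral_eq_iff_of_ae_le (hi π) (hi π') (ae_of_all _ hle)).1
    (le_antisymm (integral_mono (hi π) (hi π') hle) hcost)
  filter_upwards [hae] with s hs
  by_contra hlt
  rw [not_le] at hlt
  have : π' s = β s := if_pos hlt
  rw [this] at hs
  exact hlt.ne hs

/-- One step of the performance comparison. -/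
lemma IsPartialOTSolution.expReturn_le (h : M.IsPartialOTSolution β w π) (hw : 1 ≤ w) {n : ℕ}
    (hn : M.γ ^ n ≠ 0) :
    M.expReturn β ((M.law π (M.μ₀ ⊗ₘ π) n).fst ⊗ₘ β) ≤
      ∫ p, M.r p ∂(M.law π (M.μ₀ ⊗ₘ π) n) +
        M.γ * M.expReturn β ((M.law π (M.μ₀ ⊗ₘ π) (n + 1)).fst ⊗ₘ β) := by
  obtain ⟨C, hC⟩ := M.exists_abs_Q_le β
  have hi (η : Kernel S A) [IsMarkovKernel η] :
      Integrable (fun s => ∫ a, M.Q β s a ∂(η s)) (M.law π (M.μ₀ ⊗ₘ π) n).fst :=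
    integrable_of_measurable_of_abs_le
      (M.measurable_Q β).stronglyMeasurable.integral_kernel_prod_right'.measurable
      fun s => abs_integral_le_of_abs_le (hC s)
  calc M.expReturn β ((M.law π (M.μ₀ ⊗ₘ π) n).fst ⊗ₘ β)
      ≤ M.expReturn β ((M.law π (M.μ₀ ⊗ₘ π) n).fst ⊗ₘ π) := by
        rw [expReturn_compProd, expReturn_compProd]
        exact integral_mono_ae (hi β) (hi π)
          ((h.1.fst_law_absolutelyContinuous hn).ae_le (h.ae_integral_Q_le hw))
    _ = _ := by
        rw [← law_eq_compProd, expReturn_eq_add, step_comp, fst_law_succ]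

end Optimality

end MDP

end OfflineRL

end

open OfflineRL.MDP in
theorem mainTheorem1 {S A : Type*} [MeasurableSpace S] [MeasurableSpace A]
    (M : OfflineRL.MDP S A)
    (β π : Kernel S A) [IsMarkovKernel β] [IsMarkovKernel π]
    (w : ℝ≥0∞) (hw : 1 ≤ w)
    (hπ : M.IsPartialOTSolution β w π) :
    M.J π ≥ M.J β := by
  -- Return of `β` when started from the `n`-th state of `π`.
  let v (n : ℕ) : ℝ := M.expReturn β ((M.law π (M.μ₀ ⊗ₘ π) n).fst ⊗ₘ β)
  let c (n : ℕ) : ℝ := ∫ p, M.r p ∂(M.law π (M.μ₀ ⊗ₘ π) n)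
  have hv0 : M.J β = v 0 := by
    simp only [v, law_zero, Measure.fst_compProd]
    rfl
  have hle (n : ℕ) : v 0 ≤ ∑ t ∈ Finset.range n, M.γ ^ t * c t + M.γ ^ n * v n := by
    induction n with
    | zero => simp
    | succ n ih =>
      refine ih.trans ?_
      rw [Finset.sum_range_succ, add_assoc, pow_succ, mul_assoc, ← mul_add]
      by_cases hn : M.γ ^ n = 0
      -- Here `γ = 0` and `n ≥ 1`, so the added terms vanish on both sides.
      · simp [hn]
      · have := mul_le_mul_of_nonneg_left (hπ.expReturn_le hw hn) (pow_nonneg M.γ_nonneg n)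
        gcongr
  have hlim : Filter.Tendsto (fun n => ∑ t ∈ Finset.range n, M.γ ^ t * c t + M.γ ^ n * v n)
      Filter.atTop (nhds (M.J π + 0)) := by
    refine (M.hasSum_expReturn π (M.μ₀ ⊗ₘ π)).tendsto_sum_nat.add ?_
    obtain ⟨C, hC⟩ := M.exists_abs_expReturn_le β
    -- The bound `C` is uniform in the starting law, so the tail `γⁿ v n` vanishes.
    refine squeeze_zero_norm (fun n => M.abs_pow_mul_le (hC _) n) ?_
    simpa using (tendsto_pow_atTop_nhds_zero_of_lt_one M.γ_nonneg M.γ_lt_one).mul_const C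
  rw [ge_iff_le, hv0, ← add_zero (M.J π)]
  exact ge_of_tendsto' hlim hle
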